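/- Let $0\le r_m\le r_p$ and let $$\mathcal E(r_p,r_m)=\Big\{(x_1,x_2)\in\mathbb R^2:\ \frac{x_1^2}{r_p^2}+\frac{x_2^2}{r_m^2}\le 1\Big\},$$ where a vanishing radius means that the corresponding coordinate is $0$. Let $Z$ be a standard normal vector in $\mathbb R^2$, and let $$C(r_p,r_m)=\sup_{P_X}\, I(X;X+Z),$$ where the supremum is over all laws $P_X$ of random vectors $X$ with $X\in\mathcal E(r_p,r_m)$ almost surely, $Z$ is independent of $X$, and $I$ denotes mutual information. Let $X^\star=(X_1^\star,X_2^\star)$ be an optimal input, that is, a random vector with $X^\star\in\mathcal E(r_p,r_m)$ almost surely whose law attains this supremum. Then the law of $X^\star$ is the only law that attains the supremum, $X^\star$ and $-X^\star$ have the same distribution, and the marginals are symmetric: $X_1^\star$ and $-X_1^\star$ have the same distribution, and $X_2^\star$ and $-X_2^\star$ have the same distribution. Moreover, if $0<r_m\le r_p\le\sqrt2$, then for $P_{X_1^\star}$-almost every $x_1$ the conditional distribution of $X_2^\star$ given $X_1^\star=x_1$ is $$P_{X_2^\star\mid X_1^\star=x_1}=\tfrac12\,\delta_{\,r_m\sqrt{1-x_1^2/r_p^2}}+\tfrac12\,\delta_{\,-r_m\sqrt{1-x_1^2/r_p^2}},$$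 where $\delta_a$ denotes the unit point mass at $a$. -/

import Mathlib

open MeasureTheory ProbabilityTheory

/-- The closed region bounded by the ellipse with semi-axes `rp` and `rm`,
`x₁² / rp² + x₂² / rm² ≤ 1`, where `a² / 0²` is read as `+∞` for `a ≠ 0` and as `0` for `a = 0`
(a vanishing semi-axis forces the corresponding coordinate to vanish). -/
def ellipseRegion (rp rm : ℝ) : Set (EuclideanSpace ℝ (Fin 2)) :=
  {x | (x 0) ^ 2 / rp ^ 2 + (x 1) ^ 2 / rm ^ 2 ≤ 1 ∧ (rp = 0 → x 0 = 0) ∧ (rm = 0 → x 1 = 0)}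

/-- The mutual information `I(U; V)` (in nats): the relative entropy of the joint law of `(U, V)`
with respect to the product of the marginal laws. -/
noncomputable def mutualInformation {Ω α β : Type*} [MeasurableSpace Ω] [MeasurableSpace α]
    [MeasurableSpace β] (U : Ω → α) (V : Ω → β) (μ : Measure Ω) : ENNReal :=
  InformationTheory.klDiv (μ.map (fun ω => (U ω, V ω))) ((μ.map U).prod (μ.map V))

/-- `I(X; X + Z)` for an input `X` of law `P` and an independent standard normal vector `Z`
in the plane, realised as the coordinates of the product space. -/
noncomputable def channelInformation (P : Measure (EuclideanSpace ℝ (Fin 2))) : ENNReal :=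
  mutualInformation
    (fun p : EuclideanSpace ℝ (Fin 2) × EuclideanSpace ℝ (Fin 2) => p.1)
    (fun p : EuclideanSpace ℝ (Fin 2) × EuclideanSpace ℝ (Fin 2) => p.1 + p.2)
    (P.prod (stdGaussian (EuclideanSpace ℝ (Fin 2))))

/-- `P` is the law of an admissible input: a probability measure carried by the region bounded
by the ellipse. -/
def IsAdmissibleInput (rp rm : ℝ) (P : Measure (EuclideanSpace ℝ (Fin 2))) : Prop :=
  IsProbabilityMeasure P ∧ ∀ᵐ x ∂P, x ∈ ellipseRegion rp rm

/-- The capacity: the supremum of `I(X; X + Z)` over all admissible input laws. -/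
noncomputable def capacity (rp rm : ℝ) : ENNReal :=
  ⨆ (P : Measure (EuclideanSpace ℝ (Fin 2))) (_ : IsAdmissibleInput rp rm P), channelInformation P

/-- `P` is a capacity-achieving (optimal) input law: an admissible law at which the supremum
defining the capacity is attained. -/
def IsOptimalInput (rp rm : ℝ) (P : Measure (EuclideanSpace ℝ (Fin 2))) : Prop :=
  IsAdmissibleInput rp rm P ∧ channelInformation P = capacity rp rm

/-! Use the standard normal law as reference measure. The Cameron–Martin formula gives the output at
input `x` the density `exp(⟨x, y⟩ - ‖x‖²/2)`, and `I(X; X + Z)` becomes the mean under `P` of the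
output divergence `D_P(x)` (`channelInformation_ne_top_and_toReal`). Averaging `D_P` under another
input `Q` gives the information of `Q` plus the relative entropy of the two output laws
(`integral_outputDivergence_eq_add`).

This identity yields uniqueness: the midpoint of two optimal laws would do better unless both
outputs agree, and the output determines the input because the Gaussian characteristic function
never vanishes. Uniqueness yields symmetry, since isometries preserving the region preserve
optimality. Perturbing `P` towards a point mass yields the Kuhn–Tucker conditions: `D_P` is at most
its mean on the region, with equality `P`-almost everywhere.

For the conditional law, `D_P(x) = ‖x‖²/2 - E log p(x + Z)` with `p` the output density. The Hessian
of `log p` is the posterior covariance, so the Laplacian of `D_P` is at least `2 - E[s(x + Z)]`,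
where `s(y)` is the posterior mean of `‖X‖²` given output `y`. If `rp ≤ √2` and `P` charges the
interior, this is positive, so `D_P` cannot be maximal at an interior point. The argument is run
with second differences, avoiding differentiation under the integral. Hence `P` lives on the
boundary, where `x₁` leaves two values of `x₂`; reflection symmetry weights them equally. -/

/-- The Euclidean plane. -/
abbrev Plane := EuclideanSpace ℝ (Fin 2)

/-! ### Gaussian shifts and the Cameron–Martin formula -/

/-- The density, with respect to the standard normal law, of the normal law of mean `x` and
identity covariance. -/
noncomputable def shiftDensity (x y : Plane) : ℝ := Real.exp (inner ℝ x y - ‖x‖ ^ 2 / 2)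

lemma shiftDensity_pos (x y : Plane) : 0 < shiftDensity x y := Real.exp_pos _

lemma continuous_uncurry_shiftDensity :
    Continuous (fun p : Plane × Plane => shiftDensity p.1 p.2) := by
  unfold shiftDensity; fun_prop

lemma measurable_uncurry_shiftDensity :
    Measurable (fun p : Plane × Plane => shiftDensity p.1 p.2) :=
  continuous_uncurry_shiftDensity.measurable

lemma continuous_shiftDensity (x : Plane) : Continuous (shiftDensity x) := by
  unfold shiftDensity; fun_prop

lemma continuous_shiftDensity_left (y : Plane) : Continuous (fun x => shiftDensity x y) := by
  unfold shiftDensity; fun_prop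

lemma log_shiftDensity (x y : Plane) :
    Real.log (shiftDensity x y) = inner ℝ x y - ‖x‖ ^ 2 / 2 := Real.log_exp _

/-- Fernique's theorem plus completing the square. Every domination argument below reduces to this
bound. -/
lemma integrable_exp_mul_norm_stdGaussian (c : ℝ) :
    Integrable (fun y : Plane => Real.exp (c * ‖y‖)) (stdGaussian Plane) := by
  obtain ⟨C, hC, hint⟩ := IsGaussian.exists_integrable_exp_sq (stdGaussian Plane)
  refine (hint.const_mul (Real.exp (c ^ 2 / (4 * C)))).mono'
    (by fun_prop) (ae_of_all _ fun y => ?_)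
  rw [Real.norm_eq_abs, Real.abs_exp, ← Real.exp_add]
  apply Real.exp_le_exp.mpr
  have : c ^ 2 / (4 * C) + C * ‖y‖ ^ 2 - c * ‖y‖ = (c - 2 * C * ‖y‖) ^ 2 / (4 * C) := by
    field_simp; ring
  have h2 : 0 ≤ (c - 2 * C * ‖y‖) ^ 2 / (4 * C) := by positivity
  linarith

lemma shiftDensity_le {x : Plane} {R : ℝ} (hx : ‖x‖ ≤ R) (y : Plane) :
    shiftDensity x y ≤ Real.exp (R * ‖y‖) := by
  apply Real.exp_le_exp.mpr
  have h1 := real_inner_le_norm x y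
  have h2 : ‖x‖ * ‖y‖ ≤ R * ‖y‖ := by gcongr
  nlinarith [sq_nonneg ‖x‖]

lemma le_shiftDensity {x : Plane} {R : ℝ} (hx : ‖x‖ ≤ R) (y : Plane) :
    Real.exp (-(R * ‖y‖ + R ^ 2 / 2)) ≤ shiftDensity x y := by
  apply Real.exp_le_exp.mpr
  have h1 := neg_le_of_abs_le (abs_real_inner_le_norm x y)
  have h2 : ‖x‖ * ‖y‖ ≤ R * ‖y‖ := by gcongr
  have h3 : ‖x‖ ^ 2 ≤ R ^ 2 := by gcongr
  linarith

lemma integrable_shiftDensity (x : Plane) :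
    Integrable (shiftDensity x) (stdGaussian Plane) :=
  (integrable_exp_mul_norm_stdGaussian ‖x‖).mono' (continuous_shiftDensity x).aestronglyMeasurable
    (ae_of_all _ fun y => by
      rw [Real.norm_eq_abs, abs_of_pos (shiftDensity_pos x y)]
      exact shiftDensity_le le_rfl y)

/-- The integrand factors over coordinates into `exp((xᵢ + i tᵢ) yᵢ)`, so the one-dimensional
complex moment generating function suffices. -/
lemma integral_shiftDensity_mul_cexp (x t : Plane) :
    ∫ y, (shiftDensity x y : ℂ) * Complex.exp (inner ℝ y t * Complex.I) ∂(stdGaussian Plane)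
      = Complex.exp (-‖t‖ ^ 2 / 2) * Complex.exp (inner ℝ x t * Complex.I) := by
  have hm : AEStronglyMeasurable
      (fun y : Plane => (shiftDensity x y : ℂ) * Complex.exp (inner ℝ y t * Complex.I))
      ((Measure.pi fun _ : Fin 2 => gaussianReal 0 1).map (WithLp.toLp 2)) := by
    have := continuous_shiftDensity x
    exact Continuous.aestronglyMeasurable (by fun_prop)
  rw [← map_pi_eq_stdGaussian, integral_map (by fun_prop) hm]
  have key : ∀ y : Fin 2 → ℝ, ((shiftDensity x (WithLp.toLp 2 y) : ℝ) : ℂ) *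
      Complex.exp ((inner ℝ (WithLp.toLp 2 y) t : ℝ) * Complex.I) =
      Complex.exp (-‖x‖ ^ 2 / 2) *
        ∏ i : Fin 2, Complex.exp ((x i + t i * Complex.I) * (y i : ℝ)) := by
    intro y
    rw [shiftDensity, Complex.ofReal_exp, ← Complex.exp_add, ← Complex.exp_sum, ← Complex.exp_add]
    congr 1
    simp only [PiLp.inner_apply, Fin.sum_univ_two, RCLike.inner_apply, conj_trivial]
    push_cast
    ring
  simp_rw [key]
  rw [integral_const_mul,
    integral_fintype_prod_eq_prod (f := fun i (u : ℝ) => Complex.exp ((x i + t i * Complex.I) * u))]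
  have h1 : ∀ z : ℂ, ∫ u : ℝ, Complex.exp (z * u) ∂(gaussianReal 0 1) = Complex.exp (z ^ 2 / 2) := by
    intro z
    have := complexMGF_id_gaussianReal (μ := 0) (v := 1) z
    rw [complexMGF] at this
    simpa using this
  simp_rw [h1]
  rw [← Complex.exp_sum, ← Complex.exp_add, ← Complex.exp_add]
  congr 1
  have hx : ((‖x‖ : ℝ) : ℂ) ^ 2 = (x 0 : ℂ) ^ 2 + (x 1 : ℂ) ^ 2 := by
    rw [← Complex.ofReal_pow, EuclideanSpace.real_norm_sq_eq]; simp
  have ht : ((‖t‖ : ℝ) : ℂ) ^ 2 = (t 0 : ℂ) ^ 2 + (t 1 : ℂ) ^ 2 := by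
    rw [← Complex.ofReal_pow, EuclideanSpace.real_norm_sq_eq]; simp
  rw [hx, ht]
  simp only [PiLp.inner_apply, Fin.sum_univ_two, RCLike.inner_apply, conj_trivial]
  push_cast
  ring_nf
  simp only [Complex.I_sq]
  ring

/-- The Cameron–Martin formula for the standard normal law of the plane. -/
lemma map_const_add_stdGaussian (x : Plane) :
    (stdGaussian Plane).map (fun z => x + z) =
      (stdGaussian Plane).withDensity (fun y => ENNReal.ofReal (shiftDensity x y)) := by
  have : IsFiniteMeasure
      ((stdGaussian Plane).withDensity (fun y => ENNReal.ofReal (shiftDensity x y))) :=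
    isFiniteMeasure_withDensity_ofReal (integrable_shiftDensity x).2
  have : IsProbabilityMeasure ((stdGaussian Plane).map (fun z => x + z)) :=
    Measure.isProbabilityMeasure_map (by fun_prop)
  apply Measure.ext_of_charFun
  ext t
  have hl : charFun ((stdGaussian Plane).map (fun z => x + z)) t =
      Complex.exp (-‖t‖ ^ 2 / 2) * Complex.exp (inner ℝ x t * Complex.I) := by
    rw [charFun_map_const_add, charFun_stdGaussian, real_inner_comm]
  rw [hl, charFun_apply, integral_withDensity_eq_integral_toReal_smul
    ((continuous_shiftDensity x).measurable.ennreal_ofReal) (by simp),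
    ← integral_shiftDensity_mul_cexp]
  refine integral_congr_ae (ae_of_all _ fun y => ?_)
  simp [ENNReal.toReal_ofReal (shiftDensity_pos x y).le]

lemma lintegral_comp_const_add_stdGaussian (x : Plane) {g : Plane → ENNReal} (hg : Measurable g) :
    ∫⁻ z, g (x + z) ∂(stdGaussian Plane) =
      ∫⁻ y, ENNReal.ofReal (shiftDensity x y) * g y ∂(stdGaussian Plane) := by
  rw [← lintegral_map hg (by fun_prop : Measurable fun z => x + z), map_const_add_stdGaussian,
    lintegral_withDensity_eq_lintegral_mul _
      ((continuous_shiftDensity x).measurable.ennreal_ofReal) hg]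
  rfl

/-- The joint law of the input and the output of the channel has density `shiftDensity`. -/
lemma map_prodMk_add_stdGaussian (P : Measure Plane) [SFinite P] :
    (P.prod (stdGaussian Plane)).map (fun p => (p.1, p.1 + p.2)) =
      (P.prod (stdGaussian Plane)).withDensity
        (fun p => ENNReal.ofReal (shiftDensity p.1 p.2)) := by
  refine Measure.ext_of_lintegral _ fun f hf => ?_
  have hd := measurable_uncurry_shiftDensity.ennreal_ofReal
  rw [lintegral_map hf (by fun_prop), lintegral_withDensity_eq_lintegral_mul _ hd hf,
    lintegral_prod _ (by fun_prop), lintegral_prod _ (by fun_prop)]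
  refine lintegral_congr fun x => ?_
  rw [lintegral_comp_const_add_stdGaussian x (g := fun y => f (x, y)) (by fun_prop)]
  rfl

/-! ### Output density and mutual information -/

/-- The density, with respect to the standard normal law, of the output of the channel with input
law `P`. -/
noncomputable def outputDensity (P : Measure Plane) (y : Plane) : ℝ := ∫ x, shiftDensity x y ∂P

/-- The logarithm of the likelihood ratio between the output at input `x` and the output at an
input of law `P`. -/
noncomputable def informationDensity (P : Measure Plane) (x y : Plane) : ℝ :=
  Real.log (shiftDensity x y) - Real.log (outputDensity P y)

/-- The relative entropy of the output at input `x` with respect to the output law of `P`. -/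
noncomputable def outputDivergence (P : Measure Plane) (x : Plane) : ℝ :=
  ∫ z, informationDensity P x (x + z) ∂(stdGaussian Plane)

lemma integrable_of_continuous_of_ae_norm_le {P : Measure Plane} [IsFiniteMeasure P] {R : ℝ}
    (hP : ∀ᵐ x ∂P, ‖x‖ ≤ R) {f : Plane → ℝ} (hf : Continuous f) : Integrable f P := by
  obtain ⟨C, hC⟩ := (isCompact_closedBall (0 : Plane) R).exists_bound_of_continuousOn
    hf.continuousOn
  refine Integrable.of_bound hf.aestronglyMeasurable C ?_
  filter_upwards [hP] with x hx
  exact hC x (by simpa using hx)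

lemma measurable_outputDensity (P : Measure Plane) [SFinite P] : Measurable (outputDensity P) :=
  (measurable_uncurry_shiftDensity.stronglyMeasurable.integral_prod_left').measurable

section Bounded

variable {P : Measure Plane} [IsProbabilityMeasure P] {R : ℝ}

lemma outputDensity_le (hP : ∀ᵐ x ∂P, ‖x‖ ≤ R) (y : Plane) :
    outputDensity P y ≤ Real.exp (R * ‖y‖) := by
  have h := integral_mono_ae
    (integrable_of_continuous_of_ae_norm_le hP (continuous_shiftDensity_left y))
    (integrable_const (Real.exp (R * ‖y‖)))
    (by filter_upwards [hP] with x hx using shiftDensity_le hx y)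
  simpa [outputDensity] using h

lemma le_outputDensity (hP : ∀ᵐ x ∂P, ‖x‖ ≤ R) (y : Plane) :
    Real.exp (-(R * ‖y‖ + R ^ 2 / 2)) ≤ outputDensity P y := by
  have h := integral_mono_ae (integrable_const (Real.exp (-(R * ‖y‖ + R ^ 2 / 2))))
    (integrable_of_continuous_of_ae_norm_le hP (continuous_shiftDensity_left y))
    (by filter_upwards [hP] with x hx using le_shiftDensity hx y)
  simpa [outputDensity] using h

lemma outputDensity_pos (hP : ∀ᵐ x ∂P, ‖x‖ ≤ R) (y : Plane) : 0 < outputDensity P y :=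
  (Real.exp_pos _).trans_le (le_outputDensity hP y)

lemma log_outputDensity_le (hP : ∀ᵐ x ∂P, ‖x‖ ≤ R) (y : Plane) :
    Real.log (outputDensity P y) ≤ R * ‖y‖ :=
  (Real.log_le_iff_le_exp (outputDensity_pos hP y)).mpr (outputDensity_le hP y)

lemma le_log_outputDensity (hP : ∀ᵐ x ∂P, ‖x‖ ≤ R) (y : Plane) :
    -(R * ‖y‖ + R ^ 2 / 2) ≤ Real.log (outputDensity P y) :=
  (Real.le_log_iff_exp_le (outputDensity_pos hP y)).mpr (le_outputDensity hP y)

lemma integrable_outputDensity (hP : ∀ᵐ x ∂P, ‖x‖ ≤ R) :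
    Integrable (outputDensity P) (stdGaussian Plane) :=
  (integrable_exp_mul_norm_stdGaussian R).mono' (measurable_outputDensity P).aestronglyMeasurable
    (ae_of_all _ fun y => by
      rw [Real.norm_eq_abs, abs_of_pos (outputDensity_pos hP y)]
      exact outputDensity_le hP y)

lemma measurable_uncurry_informationDensity :
    Measurable (fun p : Plane × Plane => informationDensity P p.1 p.2) := by
  have h1 := measurable_uncurry_shiftDensity
  have h2 := measurable_outputDensity P
  unfold informationDensity
  fun_prop

/-- Both densities lie between exponentials of linear functions of `‖y‖`, so the logarithms grow at
most linearly. -/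
lemma abs_informationDensity_le (hP : ∀ᵐ x ∂P, ‖x‖ ≤ R) {x : Plane} (hx : ‖x‖ ≤ R) (y : Plane) :
    |informationDensity P x y| ≤ 2 * R * ‖y‖ + R ^ 2 / 2 := by
  have h1 := (Real.log_le_iff_le_exp (shiftDensity_pos x y)).mpr (shiftDensity_le hx y)
  have h2 := (Real.le_log_iff_exp_le (shiftDensity_pos x y)).mpr (le_shiftDensity hx y)
  have h3 := log_outputDensity_le hP y
  have h4 := le_log_outputDensity hP y
  rw [informationDensity, abs_le]
  constructor <;> linarith

lemma integrable_informationDensity (hP : ∀ᵐ x ∂P, ‖x‖ ≤ R)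
    {Q : Measure Plane} [IsProbabilityMeasure Q] (hQ : ∀ᵐ x ∂Q, ‖x‖ ≤ R) :
    Integrable (fun p : Plane × Plane => informationDensity P p.1 (p.1 + p.2))
      (Q.prod (stdGaussian Plane)) := by
  have hz : Integrable (fun p : Plane × Plane => ‖p.2‖) (Q.prod (stdGaussian Plane)) :=
    (IsGaussian.integrable_id (μ := stdGaussian Plane)).norm.comp_snd Q
  refine ((hz.const_mul (2 * R)).add (integrable_const (2 * R * R + R ^ 2 / 2))).mono'
    ((measurable_uncurry_informationDensity (P := P)).comp
      (by fun_prop : Measurable fun p : Plane × Plane => (p.1, p.1 + p.2))).aestronglyMeasurable ?_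
  have hQ' : ∀ᵐ p ∂(Q.prod (stdGaussian Plane)), ‖p.1‖ ≤ R :=
    Measure.quasiMeasurePreserving_fst.ae hQ
  filter_upwards [hQ'] with p hp
  have hR : 0 ≤ R := (norm_nonneg _).trans hp
  have h1 := abs_informationDensity_le hP hp (p.1 + p.2)
  have h2 : ‖p.1 + p.2‖ ≤ R + ‖p.2‖ := (norm_add_le _ _).trans (by gcongr)
  have h3 : 2 * R * ‖p.1 + p.2‖ ≤ 2 * R * (R + ‖p.2‖) := by gcongr
  rw [Real.norm_eq_abs]
  simp only [Pi.add_apply]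
  linarith

lemma integrable_outputDivergence (hP : ∀ᵐ x ∂P, ‖x‖ ≤ R)
    {Q : Measure Plane} [IsProbabilityMeasure Q] (hQ : ∀ᵐ x ∂Q, ‖x‖ ≤ R) :
    Integrable (outputDivergence P) Q :=
  (integrable_informationDensity hP hQ).integral_prod_left

lemma withDensity_outputDensity (hP : ∀ᵐ x ∂P, ‖x‖ ≤ R) :
    (P.prod (stdGaussian Plane)).map (fun p => p.1 + p.2) =
      (stdGaussian Plane).withDensity (fun y => ENNReal.ofReal (outputDensity P y)) := by
  have hm := (measurable_outputDensity P).ennreal_ofReal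
  have hd := measurable_uncurry_shiftDensity.ennreal_ofReal
  have h1 : (P.prod (stdGaussian Plane)).map (fun p => p.1 + p.2) =
      ((P.prod (stdGaussian Plane)).map (fun p => (p.1, p.1 + p.2))).map Prod.snd :=
    (Measure.map_map measurable_snd
      (by fun_prop : Measurable fun p : Plane × Plane => (p.1, p.1 + p.2))).symm
  rw [h1, map_prodMk_add_stdGaussian]
  refine Measure.ext_of_lintegral _ fun f hf => ?_
  have hf2 : Measurable fun p : Plane × Plane => f p.2 := hf.comp measurable_snd
  rw [lintegral_map hf measurable_snd, lintegral_withDensity_eq_lintegral_mul _ hd hf2,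
    lintegral_withDensity_eq_lintegral_mul _ hm hf,
    lintegral_prod_symm _ (hd.mul hf2).aemeasurable]
  refine lintegral_congr fun y => ?_
  simp only [Pi.mul_apply]
  rw [lintegral_mul_const _ (continuous_shiftDensity_left y).measurable.ennreal_ofReal, outputDensity,
    ofReal_integral_eq_lintegral_ofReal
    (integrable_of_continuous_of_ae_norm_le hP (continuous_shiftDensity_left y))
    (ae_of_all _ fun x => (shiftDensity_pos x y).le)]

lemma integral_outputDensity (hP : ∀ᵐ x ∂P, ‖x‖ ≤ R) :
    ∫ y, outputDensity P y ∂(stdGaussian Plane) = 1 := by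
  have : IsProbabilityMeasure ((P.prod (stdGaussian Plane)).map (fun p => p.1 + p.2)) :=
    Measure.isProbabilityMeasure_map (by fun_prop)
  have h := measure_univ (μ := (P.prod (stdGaussian Plane)).map (fun p => p.1 + p.2))
  rw [withDensity_outputDensity hP, withDensity_apply _ MeasurableSet.univ,
    Measure.restrict_univ, ← ofReal_integral_eq_lintegral_ofReal (integrable_outputDensity hP)
    (ae_of_all _ fun y => (outputDensity_pos hP y).le)] at h
  simpa using h

lemma integral_integral_informationDensity (hP : ∀ᵐ x ∂P, ‖x‖ ≤ R)
    {Q : Measure Plane} [IsProbabilityMeasure Q] (hQ : ∀ᵐ x ∂Q, ‖x‖ ≤ R) :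
    ∫ x, outputDivergence P x ∂Q =
      ∫ p, informationDensity P p.1 (p.1 + p.2) ∂(Q.prod (stdGaussian Plane)) :=
  (integral_prod _ (integrable_informationDensity hP hQ)).symm

/-- The joint law of input and output, as a measure with a density with respect to the product
of the marginal laws. -/
lemma map_prodMk_add_eq_withDensity (hP : ∀ᵐ x ∂P, ‖x‖ ≤ R) :
    (P.prod (stdGaussian Plane)).map (fun p => (p.1, p.1 + p.2)) =
      (P.prod ((P.prod (stdGaussian Plane)).map (fun p => p.1 + p.2))).withDensity
        (fun p => ENNReal.ofReal (Real.exp (informationDensity P p.1 p.2))) := by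
  have hm := (measurable_outputDensity P).ennreal_ofReal
  have hi := (measurable_uncurry_informationDensity (P := P)).exp.ennreal_ofReal
  have hm2 : Measurable fun p : Plane × Plane => ENNReal.ofReal (outputDensity P p.2) :=
    hm.comp measurable_snd
  rw [withDensity_outputDensity hP, prod_withDensity_right hm,
    ← withDensity_mul _ hm2 hi, map_prodMk_add_stdGaussian]
  congr 1
  ext p
  simp only [Pi.mul_apply]
  rw [← ENNReal.ofReal_mul (outputDensity_pos hP _).le, informationDensity, Real.exp_sub,
    Real.exp_log (shiftDensity_pos _ _), Real.exp_log (outputDensity_pos hP _),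
    mul_div_cancel₀ _ (outputDensity_pos hP _).ne']

lemma channelInformation_ne_top_and_toReal (hP : ∀ᵐ x ∂P, ‖x‖ ≤ R) :
    channelInformation P ≠ ⊤ ∧
      (channelInformation P).toReal = ∫ x, outputDivergence P x ∂P := by
  have hi := measurable_uncurry_informationDensity (P := P)
  have hfst : (P.prod (stdGaussian Plane)).map (fun p => p.1) = P := by
    simp [Measure.map_fst_prod]
  rw [channelInformation, mutualInformation, hfst]
  have h1 : IsProbabilityMeasure ((P.prod (stdGaussian Plane)).map (fun p => p.1 + p.2)) :=
    Measure.isProbabilityMeasure_map (by fun_prop)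
  have h2 : IsProbabilityMeasure ((P.prod (stdGaussian Plane)).map (fun p => (p.1, p.1 + p.2))) :=
    Measure.isProbabilityMeasure_map (by fun_prop)
  have hJ := map_prodMk_add_eq_withDensity hP
  set J := (P.prod (stdGaussian Plane)).map (fun p => (p.1, p.1 + p.2)) with hJdef
  set N := P.prod ((P.prod (stdGaussian Plane)).map (fun p => p.1 + p.2)) with hN
  have hac : J ≪ N := hJ ▸ withDensity_absolutelyContinuous _ _
  have hllr : llr J N =ᵐ[J] fun p => informationDensity P p.1 p.2 := by
    apply hac.ae_le
    have := Measure.rnDeriv_withDensity N hi.exp.ennreal_ofReal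
    rw [← hJ] at this
    filter_upwards [this] with p hp
    rw [llr, hp, ENNReal.toReal_ofReal (Real.exp_pos _).le, Real.log_exp]
  have hint : Integrable (fun p : Plane × Plane => informationDensity P p.1 p.2) J :=
    (integrable_map_measure hi.aestronglyMeasurable (by fun_prop)).mpr
      (integrable_informationDensity hP hP)
  refine ⟨InformationTheory.klDiv_ne_top hac ((integrable_congr hllr).mpr hint), ?_⟩
  rw [InformationTheory.toReal_klDiv_of_measure_eq hac (by simp), integral_congr_ae hllr, hJdef,
    integral_map (by fun_prop) hi.aestronglyMeasurable, integral_integral_informationDensity hP hP]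

end Bounded

/-! ### Relative entropy of output laws and the compensation identity -/

/-- The integrand `a log (a / b) - a + b` of the relative entropy between two densities. -/
noncomputable def relEntropyFun (a b : ℝ) : ℝ := a * (Real.log a - Real.log b) - a + b

lemma relEntropyFun_eq {a b : ℝ} (ha : 0 < a) (hb : 0 < b) :
    relEntropyFun a b = a * (b / a - 1 - Real.log (b / a)) := by
  rw [relEntropyFun, Real.log_div hb.ne' ha.ne']
  field_simp
  ring

lemma relEntropyFun_nonneg {a b : ℝ} (ha : 0 < a) (hb : 0 < b) : 0 ≤ relEntropyFun a b := by
  rw [relEntropyFun_eq ha hb]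
  have := Real.log_le_sub_one_of_pos (div_pos hb ha)
  exact mul_nonneg ha.le (by linarith)

lemma eq_of_relEntropyFun_eq_zero {a b : ℝ} (ha : 0 < a) (hb : 0 < b)
    (h : relEntropyFun a b = 0) : a = b := by
  by_contra hab
  rw [relEntropyFun_eq ha hb] at h
  have := Real.log_lt_sub_one_of_pos (div_pos hb ha)
    (fun h1 => hab ((div_eq_one_iff_eq ha.ne').mp h1).symm)
  have := mul_pos ha (by linarith : 0 < b / a - 1 - Real.log (b / a))
  linarith

/-- The chi-square bound. Being quadratic in `a - b`, it makes the entropy term second order in the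
Kuhn–Tucker perturbation. -/
lemma relEntropyFun_le {a b : ℝ} (ha : 0 < a) (hb : 0 < b) :
    relEntropyFun a b ≤ (a - b) ^ 2 / b := by
  have h := Real.log_le_sub_one_of_pos (div_pos ha hb)
  rw [Real.log_div ha.ne' hb.ne'] at h
  have h2 : (a - b) ^ 2 / b = a * (a / b - 1) - a + b := by field_simp; ring
  rw [h2, relEntropyFun]
  have := mul_le_mul_of_nonneg_left h ha.le
  linarith

lemma integrable_outputDensity_mul_log_sub {P Q : Measure Plane} [IsProbabilityMeasure P]
    [IsProbabilityMeasure Q] {R : ℝ} (hP : ∀ᵐ x ∂P, ‖x‖ ≤ R) (hQ : ∀ᵐ x ∂Q, ‖x‖ ≤ R) :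
    Integrable (fun y => outputDensity Q y *
      (Real.log (outputDensity Q y) - Real.log (outputDensity P y))) (stdGaussian Plane) := by
  have hm := measurable_outputDensity P
  have hm' := measurable_outputDensity Q
  refine ((integrable_exp_mul_norm_stdGaussian (3 * R)).const_mul (Real.exp (R ^ 2 / 2))).mono'
    (by fun_prop) (ae_of_all _ fun y => ?_)
  have h1 := log_outputDensity_le hP y
  have h2 := le_log_outputDensity hP y
  have h3 := log_outputDensity_le hQ y
  have h4 := le_log_outputDensity hQ y
  rw [norm_mul, Real.norm_eq_abs, Real.norm_eq_abs, abs_of_pos (outputDensity_pos hQ y)]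
  have h5 : |Real.log (outputDensity Q y) - Real.log (outputDensity P y)| ≤
      Real.exp (2 * R * ‖y‖ + R ^ 2 / 2) := by
    have := Real.add_one_le_exp (2 * R * ‖y‖ + R ^ 2 / 2)
    rw [abs_le]
    constructor <;> linarith
  calc _ ≤ Real.exp (R * ‖y‖) * Real.exp (2 * R * ‖y‖ + R ^ 2 / 2) := by
        gcongr
        exact outputDensity_le hQ y
    _ = _ := by rw [← Real.exp_add, ← Real.exp_add]; ring_nf

lemma integrable_relEntropyFun {P Q : Measure Plane} [IsProbabilityMeasure P]
    [IsProbabilityMeasure Q] {R : ℝ} (hP : ∀ᵐ x ∂P, ‖x‖ ≤ R) (hQ : ∀ᵐ x ∂Q, ‖x‖ ≤ R) :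
    Integrable (fun y => relEntropyFun (outputDensity Q y) (outputDensity P y))
      (stdGaussian Plane) :=
  ((integrable_outputDensity_mul_log_sub hP hQ).sub (integrable_outputDensity hQ)).add
    (integrable_outputDensity hP)

/-- The compensation identity: the mean output divergence from `P` under the input `Q` exceeds
the one from `Q` by the relative entropy between the output laws. -/
lemma integral_outputDivergence_eq_add {P Q : Measure Plane} [IsProbabilityMeasure P]
    [IsProbabilityMeasure Q] {R : ℝ} (hP : ∀ᵐ x ∂P, ‖x‖ ≤ R) (hQ : ∀ᵐ x ∂Q, ‖x‖ ≤ R) :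
    ∫ x, outputDivergence P x ∂Q = ∫ x, outputDivergence Q x ∂Q +
      ∫ y, relEntropyFun (outputDensity Q y) (outputDensity P y) ∂(stdGaussian Plane) := by
  have hm := measurable_outputDensity P
  have hm' := measurable_outputDensity Q
  -- Both output densities have integral 1, so the correction `- a + b` integrates to zero.
  have h1 : ∫ y, relEntropyFun (outputDensity Q y) (outputDensity P y) ∂(stdGaussian Plane) =
      ∫ y, outputDensity Q y * (Real.log (outputDensity Q y) - Real.log (outputDensity P y))
        ∂(stdGaussian Plane) := by
    have hi := integrable_outputDensity_mul_log_sub hP hQ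
    simp only [relEntropyFun]
    have hi2 : Integrable (fun y => outputDensity Q y * (Real.log (outputDensity Q y) -
        Real.log (outputDensity P y)) - outputDensity Q y) (stdGaussian Plane) :=
      hi.sub (integrable_outputDensity hQ)
    rw [integral_add hi2 (integrable_outputDensity hP),
      integral_sub hi (integrable_outputDensity hQ), integral_outputDensity hP,
      integral_outputDensity hQ]
    ring
  have h2 : ∫ y, outputDensity Q y * (Real.log (outputDensity Q y) - Real.log (outputDensity P y))
        ∂(stdGaussian Plane) = ∫ p, (Real.log (outputDensity Q (p.1 + p.2)) -
          Real.log (outputDensity P (p.1 + p.2))) ∂(Q.prod (stdGaussian Plane)) := by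
    rw [← integral_map (φ := fun p : Plane × Plane => p.1 + p.2) (by fun_prop)
      (f := fun y => Real.log (outputDensity Q y) - Real.log (outputDensity P y)) (by fun_prop),
      withDensity_outputDensity hQ,
      integral_withDensity_eq_integral_toReal_smul hm'.ennreal_ofReal (by simp)]
    simp [ENNReal.toReal_ofReal (outputDensity_pos hQ _).le]
  rw [h1, h2, integral_integral_informationDensity hP hQ,
    integral_integral_informationDensity hQ hQ, ← sub_eq_iff_eq_add',
    ← integral_sub (integrable_informationDensity hP hQ) (integrable_informationDensity hQ hQ)]
  refine integral_congr_ae (ae_of_all _ fun p => ?_)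
  simp only [informationDensity]
  ring

/-- The output law determines the input law. -/
lemma eq_of_outputDensity_ae_eq {P Q : Measure Plane} [IsProbabilityMeasure P]
    [IsProbabilityMeasure Q] {R : ℝ} (hP : ∀ᵐ x ∂P, ‖x‖ ≤ R) (hQ : ∀ᵐ x ∂Q, ‖x‖ ≤ R)
    (h : outputDensity P =ᵐ[stdGaussian Plane] outputDensity Q) : P = Q := by
  have hconv : P.conv (stdGaussian Plane) = Q.conv (stdGaussian Plane) := by
    rw [Measure.conv, Measure.conv, withDensity_outputDensity hP, withDensity_outputDensity hQ]
    refine withDensity_congr_ae ?_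
    filter_upwards [h] with y hy
    rw [hy]
  apply Measure.ext_of_charFun
  ext t
  have ht := congrArg (fun μ => charFun μ t) hconv
  simp only [charFun_conv, charFun_stdGaussian] at ht
  -- Deconvolution: the Gaussian factor is an exponential, hence nonzero.
  exact mul_right_cancel₀ (Complex.exp_ne_zero _) ht

/-! ### Mixtures of input laws -/

/-- The mixture of two laws with weights `1 - t` and `t`. -/
noncomputable def mixture (t : ℝ) (P Q : Measure Plane) : Measure Plane :=
  ENNReal.ofReal (1 - t) • P + ENNReal.ofReal t • Q

section Mixture

variable {t : ℝ} {P Q : Measure Plane}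

lemma isProbabilityMeasure_mixture [IsProbabilityMeasure P] [IsProbabilityMeasure Q]
    (h0 : 0 ≤ t) (h1 : t ≤ 1) : IsProbabilityMeasure (mixture t P Q) := by
  constructor
  simp only [mixture, Measure.add_apply, Measure.smul_apply, measure_univ, smul_eq_mul, mul_one]
  rw [← ENNReal.ofReal_add (by linarith) h0]
  simp

lemma ae_mixture {p : Plane → Prop} (hP : ∀ᵐ x ∂P, p x) (hQ : ∀ᵐ x ∂Q, p x) :
    ∀ᵐ x ∂(mixture t P Q), p x := by
  rw [mixture, ae_add_measure_iff]
  exact ⟨Measure.ae_smul_measure hP _, Measure.ae_smul_measure hQ _⟩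

lemma integral_mixture (h0 : 0 ≤ t) (h1 : t ≤ 1) {f : Plane → ℝ} (hP : Integrable f P)
    (hQ : Integrable f Q) :
    ∫ x, f x ∂(mixture t P Q) = (1 - t) * ∫ x, f x ∂P + t * ∫ x, f x ∂Q := by
  rw [mixture, integral_add_measure (hP.smul_measure (by simp)) (hQ.smul_measure (by simp)),
    integral_smul_measure, integral_smul_measure, ENNReal.toReal_ofReal (by linarith),
    ENNReal.toReal_ofReal h0]
  simp

lemma outputDensity_mixture [IsProbabilityMeasure P] [IsProbabilityMeasure Q] {R : ℝ}
    (h0 : 0 ≤ t) (h1 : t ≤ 1) (hP : ∀ᵐ x ∂P, ‖x‖ ≤ R) (hQ : ∀ᵐ x ∂Q, ‖x‖ ≤ R) (y : Plane) :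
    outputDensity (mixture t P Q) y = (1 - t) * outputDensity P y + t * outputDensity Q y :=
  integral_mixture h0 h1
    (integrable_of_continuous_of_ae_norm_le hP (continuous_shiftDensity_left y))
    (integrable_of_continuous_of_ae_norm_le hQ (continuous_shiftDensity_left y))

end Mixture

lemma ae_dirac_of {p : Plane → Prop} {x : Plane} (hx : p x) : ∀ᵐ y ∂(Measure.dirac x), p y := by
  rw [ae_dirac_eq]
  exact hx

lemma outputDensity_dirac (x y : Plane) :
    outputDensity (Measure.dirac x) y = shiftDensity x y := integral_dirac _ _

/-! ### Uniqueness, Kuhn–Tucker conditions and invariance -/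

section Ellipse

variable {rp rm : ℝ} {P Q : Measure Plane}

lemma norm_le_of_mem_ellipseRegion (hrm : 0 ≤ rm) (hrp : rm ≤ rp) {x : Plane}
    (hx : x ∈ ellipseRegion rp rm) : ‖x‖ ≤ rp := by
  obtain ⟨h, hp, hm⟩ := hx
  -- Division by zero gives `0`, so for a vanishing radius this rests on the clause that forces the
  -- coordinate to be `0`.
  have h0 : (x 0) ^ 2 = rp ^ 2 * ((x 0) ^ 2 / rp ^ 2) := by
    rcases eq_or_ne rp 0 with h | h
    · simp [hp h]
    · field_simp
  have h1 : (x 1) ^ 2 = rm ^ 2 * ((x 1) ^ 2 / rm ^ 2) := by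
    rcases eq_or_ne rm 0 with h | h
    · simp [hm h]
    · field_simp
  have h2 : rm ^ 2 * ((x 1) ^ 2 / rm ^ 2) ≤ rp ^ 2 * ((x 1) ^ 2 / rm ^ 2) := by gcongr
  have h3 : ‖x‖ ^ 2 = (x 0) ^ 2 + (x 1) ^ 2 := by
    rw [EuclideanSpace.real_norm_sq_eq]; simp
  have h4 : rp ^ 2 * ((x 0) ^ 2 / rp ^ 2 + (x 1) ^ 2 / rm ^ 2) ≤ rp ^ 2 * 1 := by gcongr
  refine abs_le_of_sq_le_sq' ?_ (hrm.trans hrp) |>.2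
  linarith

lemma IsAdmissibleInput.ae_norm_le (hP : IsAdmissibleInput rp rm P) (hrm : 0 ≤ rm)
    (hrp : rm ≤ rp) : ∀ᵐ x ∂P, ‖x‖ ≤ rp :=
  hP.2.mono fun _ hx => norm_le_of_mem_ellipseRegion hrm hrp hx

lemma IsAdmissibleInput.mixture {t : ℝ} (h0 : 0 ≤ t) (h1 : t ≤ 1)
    (hP : IsAdmissibleInput rp rm P) (hQ : IsAdmissibleInput rp rm Q) :
    IsAdmissibleInput rp rm (mixture t P Q) := by
  have := hP.1
  have := hQ.1
  exact ⟨isProbabilityMeasure_mixture h0 h1, ae_mixture hP.2 hQ.2⟩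

lemma isAdmissibleInput_dirac {x : Plane} (hx : x ∈ ellipseRegion rp rm) :
    IsAdmissibleInput rp rm (Measure.dirac x) :=
  ⟨inferInstance, ae_dirac_of hx⟩

lemma IsOptimalInput.integral_outputDivergence_le (hrm : 0 ≤ rm) (hrp : rm ≤ rp)
    (hP : IsOptimalInput rp rm P) (hQ : IsAdmissibleInput rp rm Q) :
    ∫ x, outputDivergence Q x ∂Q ≤ ∫ x, outputDivergence P x ∂P := by
  have := hP.1.1
  have := hQ.1
  obtain ⟨hPt, hPr⟩ := channelInformation_ne_top_and_toReal (hP.1.ae_norm_le hrm hrp)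
  obtain ⟨-, hQr⟩ := channelInformation_ne_top_and_toReal (hQ.ae_norm_le hrm hrp)
  rw [← hPr, ← hQr]
  refine ENNReal.toReal_mono hPt ?_
  rw [hP.2]
  exact le_iSup₂_of_le Q hQ le_rfl

/-- The optimal input law is unique. -/
lemma IsOptimalInput.eq (hrm : 0 ≤ rm) (hrp : rm ≤ rp)
    (hP : IsOptimalInput rp rm P) (hQ : IsOptimalInput rp rm Q) : P = Q := by
  have := hP.1.1
  have := hQ.1.1
  have hPn := hP.1.ae_norm_le hrm hrp
  have hQn := hQ.1.ae_norm_le hrm hrp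
  have hT := hP.1.mixture (t := 1 / 2) (by norm_num) (by norm_num) hQ.1
  have := hT.1
  have hTn := hT.ae_norm_le hrm hrp
  have h1 := hP.integral_outputDivergence_le hrm hrp hQ.1
  have h2 := hQ.integral_outputDivergence_le hrm hrp hP.1
  have h3 := hP.integral_outputDivergence_le hrm hrp hT
  rw [integral_mixture (by norm_num) (by norm_num) (integrable_outputDivergence hTn hPn)
    (integrable_outputDivergence hTn hQn), integral_outputDivergence_eq_add hTn hPn,
    integral_outputDivergence_eq_add hTn hQn] at h3
  have hnn : ∀ {S : Measure Plane} [IsProbabilityMeasure S], (∀ᵐ x ∂S, ‖x‖ ≤ rp) →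
      0 ≤ fun y => relEntropyFun (outputDensity S y) (outputDensity (_root_.mixture (1 / 2) P Q) y) :=
    fun hS y => relEntropyFun_nonneg (outputDensity_pos hS y) (outputDensity_pos hTn y)
  have h4 := integral_nonneg (μ := stdGaussian Plane) (hnn hPn)
  have h5 := integral_nonneg (μ := stdGaussian Plane) (hnn hQn)
  -- The two informations are equal, so optimality against the midpoint leaves no room for either
  -- relative entropy.
  have h6 := (integral_eq_zero_iff_of_nonneg (hnn hPn) (integrable_relEntropyFun hTn hPn)).mp
    (by linarith)
  refine eq_of_outputDensity_ae_eq hPn hQn ?_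
  filter_upwards [h6] with y hy
  have h7 := eq_of_relEntropyFun_eq_zero (outputDensity_pos hPn y) (outputDensity_pos hTn y) hy
  rw [outputDensity_mixture (by norm_num) (by norm_num) hPn hQn] at h7
  linarith

/-- The Kuhn–Tucker condition for an optimal input law. -/
lemma IsOptimalInput.outputDivergence_le (hrm : 0 ≤ rm) (hrp : rm ≤ rp)
    (hP : IsOptimalInput rp rm P) {x : Plane} (hx : x ∈ ellipseRegion rp rm) :
    outputDivergence P x ≤ ∫ x, outputDivergence P x ∂P := by
  have := hP.1.1
  have hD := isAdmissibleInput_dirac hx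
  have hPn := hP.1.ae_norm_le hrm hrp
  have hDn := hD.ae_norm_le hrm hrp
  have hxn := norm_le_of_mem_ellipseRegion hrm hrp hx
  have hm := measurable_outputDensity P
  have hL := (continuous_shiftDensity x).measurable
  have hK : Integrable (fun y => (shiftDensity x y - outputDensity P y) ^ 2 / outputDensity P y)
      (stdGaussian Plane) := by
    refine ((integrable_exp_mul_norm_stdGaussian (3 * rp)).const_mul
      (Real.exp (rp ^ 2 / 2))).mono'
      (((hL.sub hm).pow_const 2).div hm).aestronglyMeasurable (ae_of_all _ fun y => ?_)
    have hM := outputDensity_pos hPn y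
    rw [Real.norm_eq_abs, abs_of_nonneg (by positivity)]
    have h1 : (shiftDensity x y - outputDensity P y) ^ 2 ≤ Real.exp (rp * ‖y‖) ^ 2 := by
      have h2 := shiftDensity_le hxn y
      have h3 := outputDensity_le hPn y
      have h4 := shiftDensity_pos x y
      apply sq_le_sq'  <;> linarith
    calc _ ≤ Real.exp (rp * ‖y‖) ^ 2 / Real.exp (-(rp * ‖y‖ + rp ^ 2 / 2)) := by
          gcongr
          exact le_outputDensity hPn y
      _ = _ := by
          rw [← Real.exp_nat_mul, ← Real.exp_sub, ← Real.exp_add]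
          push_cast
          ring_nf
  set K := ∫ y, (shiftDensity x y - outputDensity P y) ^ 2 / outputDensity P y
    ∂(stdGaussian Plane) with hKdef
  have key : ∀ t : ℝ, 0 < t → t ≤ 1 →
      outputDivergence P x ≤ ∫ x, outputDivergence P x ∂P + t * K := by
    intro t h0 h1
    have hT := hP.1.mixture h0.le h1 hD
    have := hT.1
    have hTn := hT.ae_norm_le hrm hrp
    have h2 := hP.integral_outputDivergence_le hrm hrp hT
    have h3 := integral_outputDivergence_eq_add hPn hTn
    rw [integral_mixture h0.le h1 (integrable_outputDivergence hPn hPn)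
      (integrable_outputDivergence hPn hDn), integral_dirac] at h3
    -- The perturbation changes the mean of `D_P` at order `t` and costs only order `t²`; dividing
    -- by `t` and letting `t → 0` gives the claim.
    have h4 : ∫ y, relEntropyFun (outputDensity (_root_.mixture t P (Measure.dirac x)) y)
        (outputDensity P y) ∂(stdGaussian Plane) ≤ t ^ 2 * K := by
      rw [hKdef, ← integral_const_mul]
      refine integral_mono (integrable_relEntropyFun hPn hTn) (hK.const_mul _) fun y => ?_
      refine (relEntropyFun_le (outputDensity_pos hTn y) (outputDensity_pos hPn y)).trans_eq ?_
      rw [outputDensity_mixture h0.le h1 hPn hDn, outputDensity_dirac]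
      ring
    refine le_of_mul_le_mul_left ?_ h0
    linarith
  have hlim : Filter.Tendsto (fun t : ℝ => ∫ x, outputDivergence P x ∂P + t * K)
      (nhdsWithin 0 (Set.Ioi 0)) (nhds (∫ x, outputDivergence P x ∂P + 0 * K)) :=
    Filter.Tendsto.mono_left (Continuous.tendsto (by fun_prop) 0) nhdsWithin_le_nhds
  rw [zero_mul, add_zero] at hlim
  refine ge_of_tendsto hlim ?_
  filter_upwards [Ioc_mem_nhdsGT (zero_lt_one' ℝ)] with t ht using key t ht.1 ht.2

/-- A function almost everywhere at most its mean equals it almost everywhere. -/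
lemma IsOptimalInput.ae_outputDivergence_eq (hrm : 0 ≤ rm) (hrp : rm ≤ rp)
    (hP : IsOptimalInput rp rm P) :
    ∀ᵐ x ∂P, outputDivergence P x = ∫ x, outputDivergence P x ∂P := by
  have := hP.1.1
  have hPn := hP.1.ae_norm_le hrm hrp
  have hi := integrable_outputDivergence hPn hPn
  have h1 : 0 ≤ᵐ[P] fun x => ∫ x, outputDivergence P x ∂P - outputDivergence P x := by
    filter_upwards [hP.1.2] with x hx
    exact sub_nonneg.mpr (hP.outputDivergence_le hrm hrp hx)
  have h2 := (integral_eq_zero_iff_of_nonneg_ae h1 ((integrable_const _).sub hi)).mp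
    (by rw [integral_sub (integrable_const _) hi]; simp)
  filter_upwards [h2] with x hx
  simp only [Pi.zero_apply] at hx
  linarith

/-- Optimality is preserved by the isometries that preserve the region. -/
lemma IsOptimalInput.map_linearIsometryEquiv (hrm : 0 ≤ rm) (hrp : rm ≤ rp)
    (hP : IsOptimalInput rp rm P) (S : Plane ≃ₗᵢ[ℝ] Plane)
    (hS : ∀ x ∈ ellipseRegion rp rm, S x ∈ ellipseRegion rp rm) :
    IsOptimalInput rp rm (P.map S) := by
  have := hP.1.1
  have hSe : MeasurableEmbedding S := S.toHomeomorph.measurableEmbedding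
  have hSm := hSe.measurable
  have : IsProbabilityMeasure (P.map S) := Measure.isProbabilityMeasure_map hSm.aemeasurable
  have hPn := hP.1.ae_norm_le hrm hrp
  have hA : IsAdmissibleInput rp rm (P.map S) :=
    ⟨inferInstance, hSe.ae_map_iff.mpr (hP.1.2.mono hS)⟩
  refine ⟨hA, ?_⟩
  rw [← hP.2]
  have hAn := hA.ae_norm_le hrm hrp
  obtain ⟨hPt, hPr⟩ := channelInformation_ne_top_and_toReal hPn
  obtain ⟨hAt, hAr⟩ := channelInformation_ne_top_and_toReal hAn
  refine (ENNReal.toReal_eq_toReal_iff' hAt hPt).mp ?_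
  have hL : ∀ x y, shiftDensity (S x) (S y) = shiftDensity x y := fun x y => by
    simp [shiftDensity]
  have hM : ∀ y, outputDensity (P.map S) (S y) = outputDensity P y := fun y => by
    rw [outputDensity, integral_map hSm.aemeasurable
      (continuous_shiftDensity_left _).aestronglyMeasurable]
    simp_rw [hL]
    rfl
  have hD : ∀ x, outputDivergence (P.map S) (S x) = outputDivergence P x := fun x => by
    -- The noise law is itself invariant under `S`.
    rw [outputDivergence, ← stdGaussian_map S, hSe.integral_map]
    simp_rw [← map_add, informationDensity, hL, hM]
    rfl
  rw [hAr, hPr, hSe.integral_map]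
  simp_rw [hD]

end Ellipse

/-! ### Second differences of the output divergence -/

/-- The conditional second moment of the `j`-th input coordinate given the output `y`. -/
noncomputable def posteriorSecondMoment (P : Measure Plane) (j : Fin 2) (y : Plane) : ℝ :=
  (∫ x, shiftDensity x y * (x j) ^ 2 ∂P) / outputDensity P y

lemma measurable_posteriorSecondMoment (P : Measure Plane) [SFinite P] (j : Fin 2) :
    Measurable (posteriorSecondMoment P j) := by
  have h : Measurable (fun p : Plane × Plane => shiftDensity p.1 p.2 * (p.1 j) ^ 2) :=
    measurable_uncurry_shiftDensity.mul (by fun_prop)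
  exact (h.stronglyMeasurable.integral_prod_left').measurable.div (measurable_outputDensity P)

lemma shiftDensity_add_single (x y : Plane) (j : Fin 2) (s : ℝ) :
    shiftDensity x (y + EuclideanSpace.single j s) = shiftDensity x y * Real.exp (s * x j) := by
  rw [shiftDensity, shiftDensity, ← Real.exp_add, inner_add_right,
    EuclideanSpace.inner_single_right]
  congr 1
  simp
  ring

lemma abs_apply_le_norm (x : Plane) (j : Fin 2) : |x j| ≤ ‖x‖ := PiLp.norm_apply_le x j

section Bounded

variable {P : Measure Plane} [IsProbabilityMeasure P] {R : ℝ}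

/-- The noise is centred, so the linear term averages out. -/
lemma outputDivergence_eq (hP : ∀ᵐ x ∂P, ‖x‖ ≤ R) (x : Plane) :
    Integrable (fun z => Real.log (outputDensity P (x + z))) (stdGaussian Plane) ∧
    outputDivergence P x =
      ‖x‖ ^ 2 / 2 - ∫ z, Real.log (outputDensity P (x + z)) ∂(stdGaussian Plane) := by
  have hz : Integrable (fun z : Plane => z) (stdGaussian Plane) := IsGaussian.integrable_id
  have hm := measurable_outputDensity P
  have h1 : Integrable (fun z => Real.log (outputDensity P (x + z))) (stdGaussian Plane) := by
    have hd : Integrable (fun z => R * ‖x + z‖ + R ^ 2 / 2) (stdGaussian Plane) :=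
      ((((integrable_const x).add hz).norm).const_mul R).add (integrable_const _)
    refine hd.mono' (hm.log.comp (measurable_const_add x)).aestronglyMeasurable (ae_of_all _ fun z => ?_)
    have h2 := log_outputDensity_le hP (x + z)
    have h3 := le_log_outputDensity hP (x + z)
    have := sq_nonneg R
    rw [Real.norm_eq_abs, abs_le]
    constructor <;> linarith
  have h2 : Integrable (fun z : Plane => inner ℝ x z) (stdGaussian Plane) := hz.const_inner x
  have h3 : ∫ z : Plane, inner ℝ x z ∂(stdGaussian Plane) = 0 :=
    integral_strongDual_stdGaussian (innerSL ℝ x)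
  have h4 : Integrable (fun z : Plane => ‖x‖ ^ 2 / 2 + inner ℝ x z) (stdGaussian Plane) :=
    (integrable_const _).add h2
  refine ⟨h1, ?_⟩
  have h5 : ∀ z, informationDensity P x (x + z) =
      (‖x‖ ^ 2 / 2 + inner ℝ x z) - Real.log (outputDensity P (x + z)) := fun z => by
    rw [informationDensity, log_shiftDensity, inner_add_right, real_inner_self_eq_norm_sq]
    ring
  rw [outputDivergence]
  simp_rw [h5]
  rw [integral_sub h4 h1, integral_add (integrable_const _) h2, h3]
  simp

lemma integrable_shiftDensity_mul_sq (hP : ∀ᵐ x ∂P, ‖x‖ ≤ R) (j : Fin 2) (y : Plane) :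
    Integrable (fun x => shiftDensity x y * (x j) ^ 2) P :=
  integrable_of_continuous_of_ae_norm_le hP
    ((continuous_shiftDensity_left y).mul (by fun_prop))

/-- Second-order expansion with a remainder uniform in `u`, from `cosh v ≤ exp(v²/2)` and `exp w ≤ 1
+ w + w²`. -/
lemma cosh_mul_le {ε u : ℝ} (h1 : ε ^ 2 ≤ 1) (hu : u ^ 2 ≤ 2) :
    Real.cosh (ε * u) ≤ 1 + ε ^ 2 / 2 * u ^ 2 + ε ^ 4 := by
  have hv0 : 0 ≤ ε ^ 2 / 2 * u ^ 2 := by positivity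
  have hv1 : ε ^ 2 / 2 * u ^ 2 ≤ ε ^ 2 := by nlinarith [sq_nonneg ε]
  have h2 := (Real.cosh_le_exp_half_sq (ε * u)).trans_eq
    (congrArg Real.exp (by ring : (ε * u) ^ 2 / 2 = ε ^ 2 / 2 * u ^ 2))
  have h3 := Real.abs_exp_sub_one_sub_id_le (x := ε ^ 2 / 2 * u ^ 2)
    (by rw [abs_of_nonneg hv0]; linarith)
  have h4 : (ε ^ 2 / 2 * u ^ 2) ^ 2 ≤ (ε ^ 2) ^ 2 := by gcongr
  have h5 := (abs_le.mp h3).2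
  nlinarith

/-- A bound for the second differences of the logarithm of the output density. -/
lemma log_outputDensity_second_difference_le (hP : ∀ᵐ x ∂P, ‖x‖ ≤ R) (hR : R ^ 2 ≤ 2)
    {ε : ℝ} (hε : ε ^ 2 ≤ 1) (j : Fin 2) (y : Plane) :
    Real.log (outputDensity P (y + EuclideanSpace.single j ε)) +
      Real.log (outputDensity P (y + EuclideanSpace.single j (-ε))) -
        2 * Real.log (outputDensity P y) ≤
      ε ^ 2 * posteriorSecondMoment P j y + 2 * ε ^ 4 := by
  have hA := outputDensity_pos hP (y + EuclideanSpace.single j ε)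
  have hB := outputDensity_pos hP (y + EuclideanSpace.single j (-ε))
  have hM := outputDensity_pos hP y
  have hL := continuous_shiftDensity_left y
  have hAi : ∀ s : ℝ, Integrable (fun x => shiftDensity x y * Real.exp (s * x j)) P := fun s =>
    integrable_of_continuous_of_ae_norm_le hP (hL.mul (by fun_prop))
  have hsum : outputDensity P (y + EuclideanSpace.single j ε) +
      outputDensity P (y + EuclideanSpace.single j (-ε)) ≤
      2 * outputDensity P y + ε ^ 2 * (∫ x, shiftDensity x y * (x j) ^ 2 ∂P)
        + 2 * ε ^ 4 * outputDensity P y := by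
    have hLi := integrable_of_continuous_of_ae_norm_le hP hL
    have hSi := integrable_shiftDensity_mul_sq hP j y
    unfold outputDensity
    simp_rw [shiftDensity_add_single]
    have hLSi : Integrable (fun x => 2 * shiftDensity x y +
        ε ^ 2 * (shiftDensity x y * (x j) ^ 2)) P := (hLi.const_mul _).add (hSi.const_mul _)
    rw [← integral_add (hAi _) (hAi _), ← integral_const_mul, ← integral_const_mul,
      ← integral_const_mul, ← integral_add (hLi.const_mul _) (hSi.const_mul _),
      ← integral_add hLSi (hLi.const_mul _)]
    refine integral_mono_ae ((hAi _).add (hAi _))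
      (hLSi.add (hLi.const_mul _)) ?_
    filter_upwards [hP] with x hx
    have hxj : (x j) ^ 2 ≤ 2 := by
      have := abs_apply_le_norm x j
      have h2 : (x j) ^ 2 ≤ R ^ 2 := sq_le_sq' (by linarith [(abs_le.mp this).1])
        (by linarith [(abs_le.mp this).2])
      linarith
    have hc := cosh_mul_le hε hxj
    rw [Real.cosh_eq] at hc
    have hLp := shiftDensity_pos x y
    rw [← neg_mul] at hc
    have := mul_le_mul_of_nonneg_left hc hLp.le
    linarith
  have hC : 0 < (outputDensity P (y + EuclideanSpace.single j ε) +
      outputDensity P (y + EuclideanSpace.single j (-ε))) / 2 := by positivity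
  set A := outputDensity P (y + EuclideanSpace.single j ε)
  set B := outputDensity P (y + EuclideanSpace.single j (-ε))
  set M := outputDensity P y with hMdef
  -- Concavity of `log`, via AM–GM. This discards the squared posterior mean: the second moment
  -- replaces the variance.
  have h1 : Real.log A + Real.log B ≤ 2 * Real.log ((A + B) / 2) := by
    rw [← Real.log_mul hA.ne' hB.ne', ← Real.log_rpow hC]
    refine Real.log_le_log (mul_pos hA hB) ?_
    norm_cast
    nlinarith [sq_nonneg (A - B)]
  have h2 : Real.log ((A + B) / 2) - Real.log M ≤ (A + B) / 2 / M - 1 := by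
    rw [← Real.log_div hC.ne' hM.ne']
    exact Real.log_le_sub_one_of_pos (div_pos hC hM)
  have h3 : (A + B) / 2 / M - 1 ≤ ε ^ 2 / 2 * posteriorSecondMoment P j y + ε ^ 4 := by
    rw [posteriorSecondMoment, ← hMdef, sub_le_iff_le_add, div_le_iff₀ hM, add_mul, add_mul,
      mul_assoc, div_mul_cancel₀ _ hM.ne']
    linarith
  linarith

lemma posteriorSecondMoment_add (hP : ∀ᵐ x ∂P, ‖x‖ ≤ R) (y : Plane) :
    posteriorSecondMoment P 0 y + posteriorSecondMoment P 1 y =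
      (∫ x, shiftDensity x y * ‖x‖ ^ 2 ∂P) / outputDensity P y := by
  rw [posteriorSecondMoment, posteriorSecondMoment, ← add_div, ← integral_add
    (integrable_shiftDensity_mul_sq hP 0 y) (integrable_shiftDensity_mul_sq hP 1 y)]
  simp_rw [EuclideanSpace.real_norm_sq_eq, Fin.sum_univ_two, mul_add]

lemma posteriorSecondMoment_nonneg (hP : ∀ᵐ x ∂P, ‖x‖ ≤ R) (j : Fin 2) (y : Plane) :
    0 ≤ posteriorSecondMoment P j y :=
  div_nonneg (integral_nonneg fun x => mul_nonneg (shiftDensity_pos x y).le (sq_nonneg _))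
    (outputDensity_pos hP y).le

/-- Posterior weights are strictly positive, so any mass where `‖x‖² < 2` survives conditioning. -/
lemma posteriorSecondMoment_add_lt (hP : ∀ᵐ x ∂P, ‖x‖ ≤ R) (hR : R ^ 2 ≤ 2)
    (h : ∃ᵐ x ∂P, ‖x‖ ^ 2 < 2) (y : Plane) :
    posteriorSecondMoment P 0 y + posteriorSecondMoment P 1 y < 2 := by
  have hL := continuous_shiftDensity_left y
  rw [posteriorSecondMoment_add hP, div_lt_iff₀ (outputDensity_pos hP y), outputDensity,
    ← integral_const_mul, ← sub_pos]
  have hi1 : Integrable (fun x => 2 * shiftDensity x y) P :=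
    (integrable_of_continuous_of_ae_norm_le hP hL).const_mul 2
  have hi2 : Integrable (fun x => shiftDensity x y * ‖x‖ ^ 2) P :=
    integrable_of_continuous_of_ae_norm_le hP (hL.mul (by fun_prop))
  have hnn : 0 ≤ᵐ[P] fun x => 2 * shiftDensity x y - shiftDensity x y * ‖x‖ ^ 2 := by
    filter_upwards [hP] with x hx
    have h1 : ‖x‖ ^ 2 ≤ R ^ 2 := by gcongr
    have h2 := mul_nonneg (shiftDensity_pos x y).le (by linarith : 0 ≤ 2 - ‖x‖ ^ 2)
    simp only [Pi.zero_apply]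
    linarith
  rw [← integral_sub hi1 hi2]
  refine lt_of_le_of_ne (integral_nonneg_of_ae hnn) fun h0 => ?_
  have h1 := (integral_eq_zero_iff_of_nonneg_ae hnn (hi1.sub hi2)).mp h0.symm
  obtain ⟨x, hx, hx'⟩ := (h.and_eventually h1).exists
  have h2 := mul_pos (shiftDensity_pos x y) (by linarith : 0 < 2 - ‖x‖ ^ 2)
  simp only [Pi.zero_apply] at hx'
  linarith

/-- The leading `ε²` is the second difference of `‖x‖²/2`; the terms linear in `ε` cancel. -/
lemma outputDivergence_second_difference_ge (hP : ∀ᵐ x ∂P, ‖x‖ ≤ R) (hR : R ^ 2 ≤ 2)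
    {ε : ℝ} (hε : ε ^ 2 ≤ 1) (j : Fin 2) (x : Plane)
    (hs : Integrable (fun z => posteriorSecondMoment P j (x + z)) (stdGaussian Plane)) :
    ε ^ 2 - ε ^ 2 * ∫ z, posteriorSecondMoment P j (x + z) ∂(stdGaussian Plane) - 2 * ε ^ 4 ≤
      outputDivergence P (x + EuclideanSpace.single j ε) +
        outputDivergence P (x + EuclideanSpace.single j (-ε)) - 2 * outputDivergence P x := by
  obtain ⟨hi1, he1⟩ := outputDivergence_eq hP (x + EuclideanSpace.single j ε)
  obtain ⟨hi2, he2⟩ := outputDivergence_eq hP (x + EuclideanSpace.single j (-ε))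
  obtain ⟨hi3, he3⟩ := outputDivergence_eq hP x
  have hn : ∀ s : ℝ, ‖x + EuclideanSpace.single j s‖ ^ 2 = ‖x‖ ^ 2 + 2 * (s * x j) + s ^ 2 := by
    intro s
    rw [norm_add_sq_real, EuclideanSpace.inner_single_right, PiLp.norm_single]
    simp
  have key := integral_mono ((hi1.add hi2).sub (hi3.const_mul 2))
    ((hs.const_mul (ε ^ 2)).add (integrable_const (2 * ε ^ 4))) (fun z => by
      have := log_outputDensity_second_difference_le hP hR hε j (x + z)
      rw [add_right_comm x z, add_right_comm x z] at this
      exact this)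
  rw [integral_sub' (hi1.add hi2) (hi3.const_mul 2), integral_add' hi1 hi2,
    integral_const_mul, integral_add' (hs.const_mul _) (integrable_const _),
    integral_const_mul] at key
  simp only [integral_const, probReal_univ, smul_eq_mul, one_mul] at key
  rw [he1, he2, he3, hn, hn]
  linarith

end Bounded

/-! ### Support on the boundary ellipse -/

section Ellipse

variable {rp rm : ℝ} {P : Measure Plane}

/-- If the larger radius is at most `√2`, an optimal input lies on the boundary ellipse. -/
lemma IsOptimalInput.ae_mem_boundary (hrm : 0 < rm) (hrp : rm ≤ rp) (h2 : rp ≤ Real.sqrt 2)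
    (hP : IsOptimalInput rp rm P) :
    ∀ᵐ x ∂P, (x 0) ^ 2 / rp ^ 2 + (x 1) ^ 2 / rm ^ 2 = 1 := by
  have := hP.1.1
  have hrp0 : 0 < rp := hrm.trans_le hrp
  have hR : rp ^ 2 ≤ 2 := by
    have := Real.sq_sqrt (zero_le_two (α := ℝ))
    nlinarith
  have hPn := hP.1.ae_norm_le hrm.le hrp
  by_contra hcon
  have hint : ∃ᵐ x ∂P, (x 0) ^ 2 / rp ^ 2 + (x 1) ^ 2 / rm ^ 2 < 1 := by
    have h3 : ∃ᵐ x ∂P, ¬((x 0) ^ 2 / rp ^ 2 + (x 1) ^ 2 / rm ^ 2 = 1) :=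
      Filter.not_eventually.mp hcon
    refine (h3.and_eventually hP.1.2).mono fun x hx => lt_of_le_of_ne hx.2.1 hx.1
  have hlt : ∃ᵐ x ∂P, ‖x‖ ^ 2 < 2 := by
    refine hint.mono fun x hx => ?_
    have h0 : (x 0) ^ 2 = rp ^ 2 * ((x 0) ^ 2 / rp ^ 2) := by field_simp
    have h1 : (x 1) ^ 2 = rm ^ 2 * ((x 1) ^ 2 / rm ^ 2) := by field_simp
    have h4 : rm ^ 2 * ((x 1) ^ 2 / rm ^ 2) ≤ rp ^ 2 * ((x 1) ^ 2 / rm ^ 2) := by gcongr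
    have h5 : rp ^ 2 * ((x 0) ^ 2 / rp ^ 2 + (x 1) ^ 2 / rm ^ 2) < rp ^ 2 * 1 := by gcongr
    rw [EuclideanSpace.real_norm_sq_eq, Fin.sum_univ_two]
    linarith
  -- An interior point where `D_P` attains its maximum over the region.
  obtain ⟨x, hx, hxD⟩ := (hint.and_eventually (hP.ae_outputDivergence_eq hrm.le hrp)).exists
  have hsb := posteriorSecondMoment_add_lt hPn hR hlt
  have hs0 := fun j => posteriorSecondMoment_nonneg hPn j
  have hs : ∀ j, Integrable (fun z => posteriorSecondMoment P j (x + z)) (stdGaussian Plane) := by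
    intro j
    refine Integrable.of_bound ((measurable_posteriorSecondMoment P j).comp
      (measurable_const_add x)).aestronglyMeasurable 2 (ae_of_all _ fun z => ?_)
    have h4 := hs0 0 (x + z)
    have h5 := hs0 1 (x + z)
    have h6 := hsb (x + z)
    rw [Real.norm_eq_abs, abs_of_nonneg (hs0 j _)]
    fin_cases j <;> simp only [Fin.zero_eta, Fin.mk_one] <;> linarith
  set S := ∫ z, (posteriorSecondMoment P 0 (x + z) + posteriorSecondMoment P 1 (x + z))
    ∂(stdGaussian Plane) with hS
  have hSlt : S < 2 := by
    have hi' : Integrable (fun z => posteriorSecondMoment P 0 (x + z) +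
        posteriorSecondMoment P 1 (x + z)) (stdGaussian Plane) := (hs 0).add (hs 1)
    have hi : Integrable (fun z => 2 - (posteriorSecondMoment P 0 (x + z) +
        posteriorSecondMoment P 1 (x + z))) (stdGaussian Plane) :=
      (integrable_const 2).sub hi'
    have hpos : 0 < ∫ z, (2 - (posteriorSecondMoment P 0 (x + z) +
        posteriorSecondMoment P 1 (x + z))) ∂(stdGaussian Plane) := by
      have hnn : 0 ≤ fun z => 2 - (posteriorSecondMoment P 0 (x + z) +
        posteriorSecondMoment P 1 (x + z)) := fun z => sub_nonneg.mpr (hsb _).le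
      refine lt_of_le_of_ne (integral_nonneg hnn) fun h0 => ?_
      obtain ⟨z, hz⟩ := ((integral_eq_zero_iff_of_nonneg hnn hi).mp h0.symm).exists
      have := hsb (x + z)
      simp only [Pi.zero_apply] at hz
      linarith
    rw [integral_sub (integrable_const 2) hi'] at hpos
    simpa using hpos
  have hnhds : ∀ j : Fin 2, ∀ σ : ℝ, ∀ᶠ ε in nhdsWithin (0 : ℝ) (Set.Ioi 0),
      x + EuclideanSpace.single j (σ * ε) ∈ ellipseRegion rp rm := by
    intro j σ
    have hc : Continuous fun ε : ℝ =>
        ((x + EuclideanSpace.single j (σ * ε)) 0) ^ 2 / rp ^ 2 +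
          ((x + EuclideanSpace.single j (σ * ε)) 1) ^ 2 / rm ^ 2 := by
      simp only [PiLp.add_apply, PiLp.single_apply]
      fin_cases j <;> simp <;> fun_prop
    have h0 : ((x + EuclideanSpace.single j (σ * 0)) 0) ^ 2 / rp ^ 2 +
          ((x + EuclideanSpace.single j (σ * 0)) 1) ^ 2 / rm ^ 2 < 1 := by simpa using hx
    have := (hc.tendsto 0).eventually (gt_mem_nhds h0)
    filter_upwards [nhdsWithin_le_nhds this] with ε hε
    exact ⟨hε.le, fun h => absurd h hrp0.ne', fun h => absurd h hrm.ne'⟩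
  -- At a maximum both coordinate second differences are nonpositive; their sum, divided by `ε²`,
  -- gives this. The limit `ε → 0` contradicts `S < 2`.
  have hev : ∀ᶠ ε in nhdsWithin (0 : ℝ) (Set.Ioi 0), 2 ≤ S + 4 * ε ^ 2 := by
    filter_upwards [hnhds 0 1, hnhds 0 (-1), hnhds 1 1, hnhds 1 (-1),
      Ioc_mem_nhdsGT (zero_lt_one' ℝ)] with ε h1 h2 h3 h4 hε
    simp only [one_mul, neg_mul] at h1 h2 h3 h4
    have hε1 : ε ^ 2 ≤ 1 := pow_le_one₀ hε.1.le hε.2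
    have d1 := hP.outputDivergence_le hrm.le hrp h1
    have d2 := hP.outputDivergence_le hrm.le hrp h2
    have d3 := hP.outputDivergence_le hrm.le hrp h3
    have d4 := hP.outputDivergence_le hrm.le hrp h4
    have e0 := outputDivergence_second_difference_ge hPn hR hε1 0 x (hs 0)
    have e1 := outputDivergence_second_difference_ge hPn hR hε1 1 x (hs 1)
    rw [integral_add (hs 0) (hs 1)] at hS
    have hε2 : 0 < ε ^ 2 := pow_pos hε.1 2
    refine le_of_mul_le_mul_left ?_ hε2
    rw [hS]
    linarith
  have hlim : Filter.Tendsto (fun ε : ℝ => S + 4 * ε ^ 2)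
      (nhdsWithin 0 (Set.Ioi 0)) (nhds (S + 4 * 0 ^ 2)) :=
    Filter.Tendsto.mono_left (Continuous.tendsto (by fun_prop) 0) nhdsWithin_le_nhds
  have := ge_of_tendsto hlim hev
  linarith

/-! ### Reflection symmetry and the conditional law -/

/-- The reflection of the plane that changes the sign of the coordinate `j`. -/
noncomputable def coordReflection (j : Fin 2) : Plane ≃ₗᵢ[ℝ] Plane :=
  LinearIsometryEquiv.piLpCongrRight 2 fun i =>
    if i = j then LinearIsometryEquiv.neg ℝ else LinearIsometryEquiv.refl ℝ ℝ

lemma coordReflection_one_apply_zero (x : Plane) : coordReflection 1 x 0 = x 0 := by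
  simp [coordReflection]

lemma coordReflection_one_apply_one (x : Plane) : coordReflection 1 x 1 = -x 1 := by
  simp [coordReflection]

lemma IsOptimalInput.map_neg (hrm : 0 ≤ rm) (hrp : rm ≤ rp) (hP : IsOptimalInput rp rm P) :
    P.map (fun x => -x) = P :=
  (hP.map_linearIsometryEquiv hrm hrp (LinearIsometryEquiv.neg ℝ)
    (fun x hx => by simpa [ellipseRegion] using hx)).eq hrm hrp hP

lemma IsOptimalInput.map_coordReflection_one (hrm : 0 ≤ rm) (hrp : rm ≤ rp)
    (hP : IsOptimalInput rp rm P) : P.map (coordReflection 1) = P :=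
  (hP.map_linearIsometryEquiv hrm hrp (coordReflection 1) (fun x hx => by
    simpa [ellipseRegion, coordReflection_one_apply_zero,
      coordReflection_one_apply_one] using hx)).eq hrm hrp hP

end Ellipse

/-- The kernel that puts mass one half at each of the points `g a` and `-g a`. -/
noncomputable def symmetricPairKernel (g : ℝ → ℝ) (hg : Measurable g) : Kernel ℝ ℝ where
  toFun a := (2⁻¹ : ENNReal) • Measure.dirac (g a) + (2⁻¹ : ENNReal) • Measure.dirac (-g a)
  measurable' := by
    have h1 := Measure.measurable_dirac.comp hg
    have h2 := Measure.measurable_dirac.comp hg.neg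
    refine Measure.measurable_of_measurable_coe _ fun s hs => ?_
    simp only [Measure.add_apply, Measure.smul_apply, smul_eq_mul]
    exact (((Measure.measurable_coe hs).comp h1).const_mul _).add
      (((Measure.measurable_coe hs).comp h2).const_mul _)

instance (g : ℝ → ℝ) (hg : Measurable g) : IsMarkovKernel (symmetricPairKernel g hg) where
  isProbabilityMeasure a := ⟨by
    change ((2⁻¹ : ENNReal) • Measure.dirac (g a) + (2⁻¹ : ENNReal) • Measure.dirac (-g a)) _ = 1
    simp [ENNReal.inv_two_add_inv_two]⟩

/-- Averaging a test function over the reflection does not change its integral, and on the two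
graphs `±g` that average is the kernel integral whichever sign holds. -/
lemma map_prodMk_eq_compProd_symmetricPairKernel {P : Measure Plane} [IsProbabilityMeasure P]
    (hsymm : P.map (coordReflection 1) = P) {g : ℝ → ℝ} (hg : Measurable g)
    (h : ∀ᵐ x ∂P, x 1 = g (x 0) ∨ x 1 = -g (x 0)) :
    P.map (fun x => (x 0, x 1)) = (P.map fun x => x 0) ⊗ₘ symmetricPairKernel g hg := by
  have : IsProbabilityMeasure (P.map fun x : Plane => x 0) :=
    Measure.isProbabilityMeasure_map (by fun_prop)
  refine Measure.ext_of_lintegral _ fun f hf => ?_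
  rw [Measure.lintegral_compProd hf, lintegral_map hf (by fun_prop),
    lintegral_map (hf.lintegral_kernel_prod_right') (by fun_prop)]
  have h1 : ∀ a, ∫⁻ b, f (a, b) ∂(symmetricPairKernel g hg a) =
      2⁻¹ * f (a, g a) + 2⁻¹ * f (a, -g a) := fun a => by
    change ∫⁻ b, f (a, b) ∂((2⁻¹ : ENNReal) • Measure.dirac (g a) +
      (2⁻¹ : ENNReal) • Measure.dirac (-g a)) = _
    simp [lintegral_add_measure, lintegral_smul_measure]
  simp_rw [h1]
  have h2 : ∫⁻ x : Plane, f (x 0, -x 1) ∂P = ∫⁻ x : Plane, f (x 0, x 1) ∂P := by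
    conv_rhs => rw [← hsymm]
    rw [lintegral_map (by fun_prop) (coordReflection 1).continuous.measurable]
    simp_rw [coordReflection_one_apply_zero, coordReflection_one_apply_one]
  have h3 : ∫⁻ x : Plane, (2⁻¹ * f (x 0, x 1) + 2⁻¹ * f (x 0, -x 1)) ∂P =
      ∫⁻ x : Plane, f (x 0, x 1) ∂P := by
    rw [lintegral_add_left (by fun_prop), lintegral_const_mul _ (by fun_prop),
      lintegral_const_mul _ (by fun_prop), h2, ← add_mul, ENNReal.inv_two_add_inv_two, one_mul]
  rw [← h3]
  refine lintegral_congr_ae ?_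
  filter_upwards [h] with x hx
  rcases hx with hx | hx <;> rw [hx]
  rw [neg_neg, add_comm]

theorem proposition1 {Ω : Type*} [MeasurableSpace Ω] (μ : Measure Ω) [IsProbabilityMeasure μ]
    (rp rm : ℝ) (hrm : 0 ≤ rm) (hrp : rm ≤ rp)
    (X : Ω → EuclideanSpace ℝ (Fin 2)) (hX : AEMeasurable X μ)
    (hopt : IsOptimalInput rp rm (μ.map X)) :
    -- the optimal input law is unique
    (∀ Q : Measure (EuclideanSpace ℝ (Fin 2)), IsOptimalInput rp rm Q → Q = μ.map X) ∧
    -- the optimal input and both of its marginals are symmetric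
    IdentDistrib X (fun ω => -X ω) μ μ ∧
    IdentDistrib (fun ω => (X ω 0 : ℝ)) (fun ω => (-X ω 0 : ℝ)) μ μ ∧
    IdentDistrib (fun ω => (X ω 1 : ℝ)) (fun ω => (-X ω 1 : ℝ)) μ μ ∧
    -- the conditional law of the second coordinate given the first
    (0 < rm → rp ≤ Real.sqrt 2 →
      ∀ᵐ x₁ : ℝ ∂(μ.map (fun ω => (X ω 0 : ℝ))),
        condDistrib (fun ω => (X ω 1 : ℝ)) (fun ω => (X ω 0 : ℝ)) μ x₁ =
          (2⁻¹ : ENNReal) • Measure.dirac (rm * Real.sqrt (1 - x₁ ^ 2 / rp ^ 2)) +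
          (2⁻¹ : ENNReal) • Measure.dirac (-(rm * Real.sqrt (1 - x₁ ^ 2 / rp ^ 2)))) := by
  have hneg : IdentDistrib X (fun ω => -X ω) μ μ := by
    refine ⟨hX, hX.neg, ?_⟩
    have h := hopt.map_neg hrm hrp
    rw [AEMeasurable.map_map_of_aemeasurable (by fun_prop) hX] at h
    exact h.symm
  refine ⟨fun Q hQ => hQ.eq hrm hrp hopt, hneg,
    hneg.comp (u := fun x : Plane => x 0) (by fun_prop),
    hneg.comp (u := fun x : Plane => x 1) (by fun_prop), fun hrm0 h2 => ?_⟩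
  have hP : IsProbabilityMeasure (μ.map X) := hopt.1.1
  have hg : Measurable fun a : ℝ => rm * Real.sqrt (1 - a ^ 2 / rp ^ 2) := by fun_prop
  have hX1 : AEMeasurable (fun ω => X ω 1) μ :=
    (by fun_prop : Measurable fun x : Plane => x 1).comp_aemeasurable hX
  have hpair : ∀ᵐ x ∂(μ.map X), x 1 = rm * Real.sqrt (1 - (x 0) ^ 2 / rp ^ 2) ∨
      x 1 = -(rm * Real.sqrt (1 - (x 0) ^ 2 / rp ^ 2)) := by
    filter_upwards [hopt.ae_mem_boundary hrm0 hrp h2] with x hx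
    -- The boundary equation turns the square root into `|x 1 / rm|`.
    have h3 : 1 - (x 0) ^ 2 / rp ^ 2 = (x 1 / rm) ^ 2 := by rw [div_pow]; linarith
    rw [h3, Real.sqrt_sq_eq_abs, abs_div, abs_of_pos hrm0, mul_div_cancel₀ _ hrm0.ne']
    rcases abs_choice (x 1) with h | h <;> rw [h] <;> simp
  have hκ := map_prodMk_eq_compProd_symmetricPairKernel
    (hopt.map_coordReflection_one hrm hrp) hg hpair
  rw [AEMeasurable.map_map_of_aemeasurable (by fun_prop) hX,
    AEMeasurable.map_map_of_aemeasurable (by fun_prop) hX] at hκ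
  exact condDistrib_ae_eq_of_measure_eq_compProd (fun ω => X ω 0) hX1 hκ
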